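/- Let $G=(V,E)$ be a finite simple connected graph with $n=|V|\ge 2$ vertices. For edge weights $c\in\mathbb{R}_{>0}^E$ and an edge $e\in E$ let $$r_e(c)=\frac{\sum_{T\ni e}\prod_{t\in T}c_t}{\sum_{T}\prod_{t\in T}c_t},$$ where $T$ runs over the spanning trees of $G$, and for $v\in V$ let $p_v(c)=1-\tfrac12\sum_{u:\,uv\in E}r_{uv}(c)$. The graph $G$ is called resistance nonnegative (RN) if there are weights $c$ with $p_v(c)\ge 0$ for all $v\in V$, and resistance positive (RP) if there are weights $c$ with $p_v(c)>0$ for all $v\in V$. Let $L$ be the Laplacian matrix of $G$ with weights $c$, let $L^\dagger=(L+\tfrac1n\mathbf{1}\mathbf{1}^T)^{-1}-\tfrac1n\mathbf{1}\mathbf{1}^T$, and let $\Omega(c)=(\omega_{uv})_{u,v\in V}$ with $\omega_{uv}=L^\dagger_{uu}+L^\dagger_{vv}-2L^\dagger_{uv}$ be the resistance matrix. The weights $c$ are called normalized if the entries of $\Omega(c)^{-1}$ sum to $1$. Let $\mathcal{K}(G)=\{\Omega(c)^{-1} : c\in\mathbb{R}^E_{>0}\text{ normalized}\}$, and for $v\in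 V$ let $$\widetilde{\mathcal H}_v=\Big\{K\in \mathrm{GL}_n^{\mathrm{sym}}(\mathbb{R}) : \sum_{u\in V}K_{uv}\ge 0\Big\},\qquad \widetilde{\mathcal H}_v^{\circ}=\Big\{K\in \mathrm{GL}_n^{\mathrm{sym}}(\mathbb{R}) : \sum_{u\in V}K_{uv}> 0\Big\},$$ where $\mathrm{GL}_n^{\mathrm{sym}}(\mathbb{R})$ is the set of real symmetric invertible matrices with rows and columns indexed by $V$. Then: 1. $G$ is RN if and only if $\mathcal{K}(G)\cap\bigcap_{v\in V}\widetilde{\mathcal H}_v\neq\emptyset$. 2. $G$ is RP if and only if $\mathcal{K}(G)\cap\bigcap_{v\in V}\widetilde{\mathcal H}_v^{\circ}\neq\emptyset$. 3. $\mathcal{K}(G)$ is the semialgebraic set of all $K\in\mathrm{GL}_n^{\mathrm{sym}}(\mathbb{R})$ such that $\sum_{u,v}K_{uv}=1$; $(K^{-1})_{vv}=0$ for all $v\in V$; $K_{uv}=\big(\sum_w K_{wv}\big)\big(\sum_w K_{uw}\big)$ for all $u\ne v$ with $uv\notin E$; and $K_{uv}>\big(\sum_w K_{wv}\big)\big(\sum_w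 K_{uw}\big)$ for all $uv\in E$. 4. For all normalized weights $c$ and all $v\in V$, $p_v(c)=\sum_{u\in V}(\Omega(c)^{-1})_{uv}$. -/

import Mathlib

namespace ResistanceCurvature

/-- Edge weights are given by a function `c` on unordered pairs of vertices, of which only the
values on the edges of `G` are ever used. This says that all edge weights are positive. -/
def IsWeight {V : Type*} (G : SimpleGraph V) (c : Sym2 V → ℝ) : Prop :=
  ∀ e ∈ G.edgeSet, 0 < c e

/-- A spanning tree is a maximal acyclic set of edges. -/
def IsSpanningTree {V : Type*} (G : SimpleGraph V) (T : Finset (Sym2 V)) : Prop :=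
  Maximal (fun S : Finset (Sym2 V) =>
    (S : Set (Sym2 V)) ⊆ G.edgeSet ∧ (SimpleGraph.fromEdgeSet (S : Set (Sym2 V))).IsAcyclic) T

open scoped Classical in
/-- The finite set of all spanning trees of `G`. -/
noncomputable def spanningTrees {V : Type*} [Fintype V] (G : SimpleGraph V) :
    Finset (Finset (Sym2 V)) :=
  Finset.univ.filter (fun T => IsSpanningTree G T)

open scoped Classical in
/-- The relative resistance `r_e(c) = (∑_{T ∋ e} ∏_{t ∈ T} c_t) / (∑_T ∏_{t ∈ T} c_t)`. -/
noncomputable def relativeResistance {V : Type*} [Fintype V] (G : SimpleGraph V)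
    (c : Sym2 V → ℝ) (e : Sym2 V) : ℝ :=
  (∑ T ∈ (spanningTrees G).filter (fun T => e ∈ T), ∏ t ∈ T, c t) /
    (∑ T ∈ spanningTrees G, ∏ t ∈ T, c t)

open scoped Classical in
/-- The resistance curvature `p_v(c) = 1 - (1/2) ∑_{uv ∈ E} r_{uv}(c)` of the vertex `v`. -/
noncomputable def curvature {V : Type*} [Fintype V] (G : SimpleGraph V)
    (c : Sym2 V → ℝ) (v : V) : ℝ :=
  1 - (1 / 2) * ∑ u ∈ G.neighborFinset v, relativeResistance G c s(u, v)

/-- Resistance nonnegative graphs. -/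
def IsRN {V : Type*} [Fintype V] (G : SimpleGraph V) : Prop :=
  ∃ c : Sym2 V → ℝ, IsWeight G c ∧ ∀ v, 0 ≤ curvature G c v

/-- Resistance positive graphs. -/
def IsRP {V : Type*} [Fintype V] (G : SimpleGraph V) : Prop :=
  ∃ c : Sym2 V → ℝ, IsWeight G c ∧ ∀ v, 0 < curvature G c v

open scoped Classical in
/-- The weighted Laplacian matrix. -/
noncomputable def laplacian {V : Type*} [Fintype V] (G : SimpleGraph V)
    (c : Sym2 V → ℝ) : Matrix V V ℝ :=
  Matrix.of fun u v =>
    if u = v then ∑ w ∈ G.neighborFinset v, c s(w, v)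
    else if G.Adj u v then -c s(u, v) else 0

/-- The matrix `(1/n) 𝟏 𝟏ᵀ`. -/
noncomputable def averaging (V : Type*) [Fintype V] : Matrix V V ℝ :=
  Matrix.of fun _ _ => 1 / (Fintype.card V : ℝ)

/-- The Moore–Penrose pseudoinverse `L† = (L + (1/n) 𝟏 𝟏ᵀ)⁻¹ - (1/n) 𝟏 𝟏ᵀ` of the Laplacian of a
connected graph. -/
noncomputable def laplacianPinv {V : Type*} [Fintype V] [DecidableEq V] (G : SimpleGraph V)
    (c : Sym2 V → ℝ) : Matrix V V ℝ :=
  (laplacian G c + averaging V)⁻¹ - averaging V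

/-- The resistance matrix, with entries the effective resistances
`ω_{uv} = L†_{uu} + L†_{vv} - 2 L†_{uv}`. -/
noncomputable def resistanceMatrix {V : Type*} [Fintype V] [DecidableEq V] (G : SimpleGraph V)
    (c : Sym2 V → ℝ) : Matrix V V ℝ :=
  Matrix.of fun u v =>
    laplacianPinv G c u u + laplacianPinv G c v v - 2 * laplacianPinv G c u v

/-- The weights `c` are normalized: the entries of the inverse resistance matrix sum to one. -/
def IsNormalized {V : Type*} [Fintype V] [DecidableEq V] (G : SimpleGraph V)
    (c : Sym2 V → ℝ) : Prop :=
  ∑ u, ∑ v, (resistanceMatrix G c)⁻¹ u v = 1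

/-- The real symmetric invertible matrices with rows and columns indexed by `V`. -/
def symGL (V : Type*) [Fintype V] [DecidableEq V] : Set (Matrix V V ℝ) :=
  {K | K.IsSymm ∧ IsUnit K}

/-- `𝓚(G)`: the set of inverse resistance matrices of `G` with normalized weights. -/
def inverseResistanceSet {V : Type*} [Fintype V] [DecidableEq V] (G : SimpleGraph V) :
    Set (Matrix V V ℝ) :=
  {K | ∃ c : Sym2 V → ℝ, IsWeight G c ∧ IsNormalized G c ∧ K = (resistanceMatrix G c)⁻¹}

/-- The explicit semialgebraic set: symmetric invertible `K` with entries summing to one, whose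
inverse has zero diagonal (as a resistance matrix does), and whose off-diagonal entries are equal
to (for non-edges), respectively greater than (for edges), the product of the row sums. -/
def semialgebraicSet {V : Type*} [Fintype V] [DecidableEq V] (G : SimpleGraph V) :
    Set (Matrix V V ℝ) :=
  {K | K ∈ symGL V ∧
    (∑ u, ∑ v, K u v = 1) ∧
    (∀ v, K⁻¹ v v = 0) ∧
    (∀ u v, u ≠ v → ¬ G.Adj u v → K u v = (∑ w, K w v) * (∑ w, K u w)) ∧
    (∀ u v, G.Adj u v → K u v > (∑ w, K w v) * (∑ w, K u w))}

/-- The halfspace `∑_u K_{uv} ≥ 0` of symmetric invertible matrices. -/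
def halfspace {V : Type*} [Fintype V] [DecidableEq V] (v : V) : Set (Matrix V V ℝ) :=
  {K | K ∈ symGL V ∧ ∑ u, K u v ≥ 0}

/-- The open halfspace `∑_u K_{uv} > 0` of symmetric invertible matrices. -/
def openHalfspace {V : Type*} [Fintype V] [DecidableEq V] (v : V) : Set (Matrix V V ℝ) :=
  {K | K ∈ symGL V ∧ ∑ u, K u v > 0}

end ResistanceCurvature

/-!
Let `L` be the weighted Laplacian, `L†` its pseudoinverse, `d` the diagonal of `L†` and
`Ω = d 𝟏ᵀ + 𝟏 dᵀ - 2 L†` the resistance matrix. Everything follows from two facts.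

The first is Kirchhoff's theorem `r_{uv} = c_{uv} ω_{uv}` (`relativeResistance_eq`). The Laplacian
grounded at `v` has the determinant `∑_φ ∏_{x ≠ v} a_{x φ(x)}`, where `φ` runs over the parent maps of
trees rooted at `v` (`det_groundedLaplacian`): expanding each row multilinearly gives a sum over all
maps `φ`, and the determinant belonging to a single map is `1` or `0` according to whether its iterates
lead every vertex to the root. Parent maps correspond to spanning trees
(`sum_isParentMap_eq_sum_spanningTrees`), and Cramer's rule expresses `ω_{uv}` as a quotient of two such
determinants. As a consequence, the curvatures form the vector `p = ½ L d + (1/n) 𝟏`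
(`curvature_eq_curvatureVector`).

The second is Fiedler's identity `(p pᵀ - (τ/2) L) Ω = τ I` (`scaledInverse_mul_resistanceMatrix`), where
`Ω p = τ 𝟏` and `τ > 0`. Since `𝟏ᵀ p = 1` and `L 𝟏 = 0`, the matrix `K = p pᵀ - (τ/2) L` has column sums
`p` and total sum `1`; it equals `Ω⁻¹` exactly when the weights are normalized, and for arbitrary weights
it lies in the semialgebraic set (`scaledInverse_mem_semialgebraicSet`). Conversely, for `K` in that set
with `p = K 𝟏`, the matrix `2 (p pᵀ - K)` is the Laplacian of positive weights whose resistance matrix is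
`K⁻¹` (`exists_weight_of_mem_semialgebraicSet`). Nonnegativity and positivity of the curvature can
therefore be read off from the column sums of the elements of `𝓚(G)`.
-/

namespace ResistanceCurvature

/-! ### Rooted trees as parent maps -/

/-- The parent map of a tree on all of `V` rooted at `v`: it fixes the root, and iterating it leads
from every vertex to the root. -/
def IsParentMap {V : Type*} (v : V) (φ : V → V) : Prop :=
  φ v = v ∧ ∀ x, ∃ k : ℕ, φ^[k] x = v

/-- A nonempty set of vertices closed under taking parents contains the root. -/
theorem IsParentMap.root_mem {V : Type*} {v : V} {φ : V → V} (h : IsParentMap v φ)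
    {S : Set V} {x : V} (hx : x ∈ S) (hS : ∀ y ∈ S, φ y ∈ S) : v ∈ S := by
  obtain ⟨k, hk⟩ := h.2 x
  rw [← hk]
  exact (show Set.MapsTo φ S S from hS).iterate k hx

theorem IsParentMap.induction {V : Type*} {v : V} {φ : V → V} (h : IsParentMap v φ)
    {P : V → Prop} (h0 : P v) (hs : ∀ x, P (φ x) → P x) (x : V) : P x := by
  by_contra hx
  exact h.root_mem (S := {y | ¬ P y}) hx (fun y hy hy' => hy (hs y hy')) h0

theorem IsParentMap.apply_ne {V : Type*} {v : V} {φ : V → V} (h : IsParentMap v φ) {x : V}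
    (hx : x ≠ v) : φ x ≠ x := fun hx' =>
  hx (h.root_mem (S := {x}) rfl (by rintro y rfl; exact hx')).symm

theorem IsParentMap.apply_apply_ne {V : Type*} {v : V} {φ : V → V} (h : IsParentMap v φ) {x : V}
    (hx : x ≠ v) : φ (φ x) ≠ x := by
  intro hx'
  have hv : v ∈ ({x, φ x} : Set V) := h.root_mem (x := x) (by simp)
    (by rintro y (rfl | rfl) <;> simp [hx'])
  rcases hv with hv | hv
  · exact hx hv.symm
  · rw [← hv, h.1] at hx'
    exact hx hx'.symm

theorem isParentMap_of_lt {V : Type*} {v : V} {φ : V → V} (d : V → ℕ) (hv : φ v = v)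
    (h : ∀ x, x ≠ v → d (φ x) < d x) : IsParentMap v φ := by
  refine ⟨hv, fun x => ?_⟩
  induction hn : d x using Nat.strong_induction_on generalizing x with
  | _ n ih =>
    by_cases hx : x = v
    · exact ⟨0, hx⟩
    · obtain ⟨k, hk⟩ := ih _ (hn ▸ h x hx) (φ x) rfl
      exact ⟨k + 1, hk⟩

theorem IsParentMap.exists_depth {V : Type*} {v : V} {φ : V → V} (h : IsParentMap v φ) :
    ∃ d : V → ℕ, ∀ x, x ≠ v → d (φ x) < d x := by
  classical
  refine ⟨fun x => Nat.find (h.2 x), fun x hx => ?_⟩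
  obtain ⟨k, hk⟩ : ∃ k, Nat.find (h.2 x) = k + 1 := by
    refine Nat.exists_eq_succ_of_ne_zero fun h0 => hx ?_
    simpa [h0] using Nat.find_spec (h.2 x)
  have hs := Nat.find_spec (h.2 x)
  rw [hk] at hs
  beta_reduce
  simp only [hk]
  exact Nat.lt_succ_of_le (Nat.find_le (h := h.2 (φ x)) hs)

/-! ### The matrix-tree theorem for rooted trees -/

/-- The matrix with row `v` equal to the unit vector `e_v` and every other row `x` equal to
`∑_y a_{xy} (e_x - e_y)`: a directed weighted Laplacian grounded at `v`. -/
noncomputable def groundedLaplacian {V : Type*} [Fintype V] [DecidableEq V] (a : V → V → ℝ)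
    (v : V) : Matrix V V ℝ :=
  Matrix.of fun x => if x = v then Pi.single v 1
    else ∑ y, a x y • (Pi.single x (1 : ℝ) - Pi.single y 1)

/-- The grounded Laplacian of a single map: the row of `x ≠ v` is `e_x - e_{φ x}`, and row `v` is `e_v`. -/
noncomputable def mapLaplacian {V : Type*} [DecidableEq V] (φ : V → V)
    (v : V) : Matrix V V ℝ :=
  Matrix.of fun x => if x = v then Pi.single v 1 else Pi.single x (1 : ℝ) - Pi.single (φ x) 1

theorem groundedLaplacian_root {V : Type*} [Fintype V] [DecidableEq V] (a : V → V → ℝ) (v : V) :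
    groundedLaplacian a v v = Pi.single v 1 := if_pos rfl

theorem groundedLaplacian_of_ne {V : Type*} [Fintype V] [DecidableEq V] (a : V → V → ℝ) {v x : V}
    (hx : x ≠ v) : groundedLaplacian a v x =
      ∑ y, a x y • (Pi.single x (1 : ℝ) - Pi.single y 1) := if_neg hx

theorem mapLaplacian_root {V : Type*} [DecidableEq V] (φ : V → V) (v : V) :
    mapLaplacian φ v v = Pi.single v 1 := if_pos rfl

theorem mapLaplacian_of_ne {V : Type*} [DecidableEq V] (φ : V → V) {v x : V} (hx : x ≠ v) :
    mapLaplacian φ v x = Pi.single x (1 : ℝ) - Pi.single (φ x) 1 := if_neg hx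

/-- Ordered by depth below the root, the matrix is unitriangular. -/
theorem det_mapLaplacian_of_isParentMap {V : Type*} [Fintype V] [DecidableEq V] {φ : V → V} {v : V}
    (h : IsParentMap v φ) : (mapLaplacian φ v).det = 1 := by
  obtain ⟨d, hd⟩ := h.exists_depth
  have key : ∀ x y, d x ≤ d y → mapLaplacian φ v x y = if x = y then 1 else 0 := by
    intro x y hxy
    by_cases hx : x = v
    · subst hx
      simp [mapLaplacian_root, Pi.single_apply, eq_comm]
    · have : y ≠ φ x := by
        rintro rfl
        exact absurd (hd x hx) (not_lt.2 hxy)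
      simp [mapLaplacian_of_ne φ hx, Pi.single_apply, this, eq_comm]
  have ht : Matrix.BlockTriangular (mapLaplacian φ v) (fun x => OrderDual.toDual (d x)) := by
    intro x y hxy
    have hxy' : d x < d y := hxy
    rw [key x y hxy'.le, if_neg]
    rintro rfl
    exact lt_irrefl _ hxy'
  rw [ht.det]
  refine Finset.prod_eq_one fun k _ => ?_
  have : (mapLaplacian φ v).toSquareBlock (fun x => OrderDual.toDual (d x)) k = 1 := by
    ext x y
    have hxy : d x = d y := OrderDual.toDual.injective (x.2.trans y.2.symm)
    rw [Matrix.toSquareBlock_def, Matrix.of_apply, key _ _ hxy.le, Matrix.one_apply]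
    simp [Subtype.ext_iff]
  rw [this, Matrix.det_one]

/-- The indicator of the set of vertices which do not reach the root is in the kernel. -/
theorem det_mapLaplacian_of_not_isParentMap {V : Type*} [Fintype V] [DecidableEq V] {φ : V → V}
    {v : V} (hv : φ v = v) (h : ¬ IsParentMap v φ) : (mapLaplacian φ v).det = 0 := by
  classical
  obtain ⟨x, hx⟩ : ∃ x, ∀ k : ℕ, φ^[k] x ≠ v := by
    by_contra! hcon
    exact h ⟨hv, hcon⟩
  rw [← Matrix.exists_mulVec_eq_zero_iff]
  refine ⟨fun y => if ∃ k : ℕ, φ^[k] y = v then 0 else 1, fun h0 => ?_, ?_⟩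
  · have := congrFun h0 x
    simp [hx] at this
  · have hiff : ∀ y, (∃ k : ℕ, φ^[k] (φ y) = v) ↔ ∃ k : ℕ, φ^[k] y = v := by
      intro y
      constructor
      · rintro ⟨k, hk⟩
        exact ⟨k + 1, hk⟩
      · rintro ⟨k, hk⟩
        refine ⟨k, ?_⟩
        rw [← Function.iterate_succ_apply, Function.iterate_succ_apply', hk, hv]
    ext y
    by_cases hy : y = v
    · subst hy
      have : ∃ k : ℕ, φ^[k] y = y := ⟨0, rfl⟩
      simp [Matrix.mulVec, mapLaplacian_root, this]
    · rw [Matrix.mulVec, mapLaplacian_of_ne φ hy, sub_dotProduct]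
      simp [hiff]

open scoped Classical in
/-- The directed matrix-tree theorem. The determinant is expanded multilinearly over all choices
of an out-neighbour `φ x` for every vertex `x ≠ v`. -/
theorem det_groundedLaplacian {V : Type*} [Fintype V] (a : V → V → ℝ) (v : V) :
    (groundedLaplacian a v).det =
      ∑ φ : V → V with IsParentMap v φ, ∏ x ∈ Finset.univ.erase v, a x (φ x) := by
  -- Row `v` is written as a sum with one nonzero term, so that only maps fixing `v` contribute.
  let g : V → V → V → ℝ := fun x y =>
    if x = v then (if y = v then Pi.single v 1 else 0)
    else a x y • (Pi.single x (1 : ℝ) - Pi.single y 1)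
  have hg : groundedLaplacian a v = fun x => ∑ y, g x y := by
    funext x
    by_cases hx : x = v
    · simp [groundedLaplacian_root, g, hx]
    · simp [groundedLaplacian_of_ne a hx, g, hx]
  have hexp : (groundedLaplacian a v).det =
      ∑ φ : V → V, Matrix.det (Matrix.of fun x => g x (φ x)) := by
    rw [hg]
    exact (Matrix.detRowAlternating (n := V) (R := ℝ)).toMultilinearMap.map_sum g
  rw [hexp, Finset.sum_filter]
  refine Finset.sum_congr rfl fun φ _ => ?_
  by_cases hv : φ v = v
  · have hfac : (Matrix.of fun x => g x (φ x)) =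
        Matrix.of fun x y => (if x = v then 1 else a x (φ x)) * mapLaplacian φ v x y := by
      ext x y
      by_cases hx : x = v
      · subst hx
        simp [g, hv, mapLaplacian_root]
      · simp [g, hx, mapLaplacian_of_ne φ hx]
    rw [hfac, Matrix.det_mul_column]
    have hprod : ∏ x, (if x = v then 1 else a x (φ x)) =
        ∏ x ∈ Finset.univ.erase v, a x (φ x) := by
      rw [← Finset.mul_prod_erase _ _ (Finset.mem_univ v), if_pos rfl, one_mul]
      exact Finset.prod_congr rfl fun x hx => if_neg (Finset.ne_of_mem_erase hx)
    rw [hprod]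
    split_ifs with h
    · rw [det_mapLaplacian_of_isParentMap h, mul_one]
    · rw [det_mapLaplacian_of_not_isParentMap hv h, mul_zero]
  · rw [if_neg fun h => hv h.1]
    exact Matrix.det_eq_zero_of_row_eq_zero v fun y => by simp [g, hv]

/-! ### Parent maps and spanning trees -/

open scoped Classical in
/-- The edges joining the vertices other than the root to their parents. -/
noncomputable def parentEdges {V : Type*} [Fintype V] (v : V) (φ : V → V) : Finset (Sym2 V) :=
  (Finset.univ.erase v).image fun x => s(x, φ x)

theorem mem_parentEdges {V : Type*} [Fintype V] {v : V} {φ : V → V} {e : Sym2 V} :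
    e ∈ parentEdges v φ ↔ ∃ x, x ≠ v ∧ s(x, φ x) = e := by
  simp [parentEdges]

theorem IsParentMap.injOn_edge {V : Type*} {v : V} {φ : V → V} (h : IsParentMap v φ) {x y : V}
    (hx : x ≠ v) (hxy : s(x, φ x) = s(y, φ y)) : x = y := by
  rcases Sym2.eq_iff.1 hxy with ⟨h1, _⟩ | ⟨h1, h2⟩
  · exact h1
  · exact absurd (by rw [h2, ← h1]) (h.apply_apply_ne hx)

theorem IsParentMap.connected {V : Type*} [Fintype V] {v : V} {φ : V → V} (h : IsParentMap v φ) :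
    (SimpleGraph.fromEdgeSet (parentEdges v φ : Set (Sym2 V))).Connected := by
  have hr : ∀ x, (SimpleGraph.fromEdgeSet (parentEdges v φ : Set (Sym2 V))).Reachable x v := by
    refine h.induction (SimpleGraph.Reachable.refl _) fun x hx => ?_
    by_cases hxv : x = v
    · rw [hxv]
    · refine SimpleGraph.Reachable.trans (SimpleGraph.Adj.reachable ?_) hx
      rw [SimpleGraph.fromEdgeSet_adj]
      exact ⟨Finset.mem_coe.2 (mem_parentEdges.2 ⟨x, hxv, rfl⟩), (h.apply_ne hxv).symm⟩
  have : Nonempty V := ⟨v⟩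
  exact ⟨fun x y => (hr x).trans (hr y).symm⟩

/-- The edges from vertices to their parents connect everything, and there are at most `n - 1`. -/
theorem IsParentMap.isTree {V : Type*} [Fintype V] {v : V} {φ : V → V} (h : IsParentMap v φ) :
    (SimpleGraph.fromEdgeSet (parentEdges v φ : Set (Sym2 V))).IsTree := by
  classical
  rw [SimpleGraph.isTree_iff_connected_and_card]
  refine ⟨h.connected, le_antisymm ?_ h.connected.card_vert_le_card_edgeSet_add_one⟩
  have h1 : Nat.card (SimpleGraph.fromEdgeSet (parentEdges v φ : Set (Sym2 V))).edgeSet ≤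
      (parentEdges v φ).card := by
    rw [← Set.ncard_coe_finset, ← Nat.card_coe_set_eq]
    refine Nat.card_mono (Finset.finite_toSet _) ?_
    rw [SimpleGraph.edgeSet_fromEdgeSet]
    exact Set.sdiff_subset
  have h2 : (parentEdges v φ).card ≤ Fintype.card V - 1 := by
    refine Finset.card_image_le.trans ?_
    rw [Finset.card_erase_of_mem (Finset.mem_univ v), Finset.card_univ]
  have h3 : 0 < Fintype.card V := Fintype.card_pos_iff.2 ⟨v⟩
  rw [Nat.card_eq_fintype_card (α := V)]
  omega

/-- Transfers Mathlib's characterization of maximal acyclic subgraphs to finite edge sets. -/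
theorem isSpanningTree_iff {V : Type*} [Fintype V] {G : SimpleGraph V} (hG : G.Connected)
    {T : Finset (Sym2 V)} : IsSpanningTree G T ↔ (T : Set (Sym2 V)) ⊆ G.edgeSet ∧
      (SimpleGraph.fromEdgeSet (T : Set (Sym2 V))).IsTree := by
  classical
  have hes : ∀ {S : Finset (Sym2 V)}, (S : Set (Sym2 V)) ⊆ G.edgeSet →
      (SimpleGraph.fromEdgeSet (S : Set (Sym2 V))).edgeSet = S := by
    intro S hS
    refine (SimpleGraph.edgeSet_eq_iff _ _).2 ⟨rfl, ?_⟩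
    rw [Set.disjoint_left]
    exact fun e he => G.not_isDiag_of_mem_edgeSet (hS he)
  have hle : ∀ {S : Finset (Sym2 V)}, (S : Set (Sym2 V)) ⊆ G.edgeSet →
      SimpleGraph.fromEdgeSet (S : Set (Sym2 V)) ≤ G := by
    intro S hS
    rw [← SimpleGraph.edgeSet_subset_edgeSet, hes hS]
    exact hS
  constructor
  · intro h
    refine ⟨h.1.1, (hG.maximal_le_isAcyclic_iff_isTree (hle h.1.1)).1 ⟨⟨hle h.1.1, h.1.2⟩, ?_⟩⟩
    rintro H ⟨hH, hHa⟩ hTH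
    have hHf : (H.edgeFinset : Set (Sym2 V)) = H.edgeSet := by simp
    have := h.2 (y := H.edgeFinset) ⟨by rw [hHf]; exact SimpleGraph.edgeSet_mono hH,
      by rw [hHf, SimpleGraph.fromEdgeSet_edgeSet]; exact hHa⟩
      (by
        rw [← SimpleGraph.edgeSet_subset_edgeSet, hes h.1.1, ← hHf] at hTH
        exact Finset.coe_subset.1 hTH)
    rw [← SimpleGraph.edgeSet_subset_edgeSet, hes h.1.1, ← hHf]
    exact Finset.coe_subset.2 this
  · rintro ⟨hT, htree⟩
    refine ⟨⟨hT, htree.isAcyclic⟩, ?_⟩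
    rintro S ⟨hS, hSa⟩ hTS
    have := ((hG.maximal_le_isAcyclic_iff_isTree (hle hT)).2 htree).2 ⟨hle hS, hSa⟩
      (SimpleGraph.fromEdgeSet_mono (Finset.coe_subset.2 hTS))
    rw [← SimpleGraph.edgeSet_subset_edgeSet, hes hT, hes hS] at this
    exact Finset.coe_subset.1 this

theorem mem_spanningTrees {V : Type*} [Fintype V] {G : SimpleGraph V} {T : Finset (Sym2 V)} :
    T ∈ spanningTrees G ↔ IsSpanningTree G T := by
  simp [spanningTrees]

/-- In a connected graph, sending each vertex to a neighbour nearer to `v` is a parent map. -/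
theorem exists_isParentMap {V : Type*} {H : SimpleGraph V} (hH : H.Connected) (v : V) :
    ∃ φ, IsParentMap v φ ∧ ∀ x, x ≠ v → H.Adj x (φ x) := by
  classical
  have hstep : ∀ x, ∃ y, (x = v → y = v) ∧ (x ≠ v → H.Adj x y ∧ H.dist y v < H.dist x v) := by
    intro x
    by_cases hx : x = v
    · exact ⟨v, fun _ => rfl, fun h => absurd hx h⟩
    · obtain ⟨p, hp⟩ := hH.exists_walk_length_eq_dist x v
      cases p with
      | nil => exact absurd rfl hx
      | cons hadj q =>
        refine ⟨_, fun h => absurd h hx, fun _ => ⟨hadj, ?_⟩⟩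
        rw [← hp, SimpleGraph.Walk.length_cons]
        exact Nat.lt_succ_of_le (SimpleGraph.dist_le q)
  choose φ h1 h2 using hstep
  exact ⟨φ, isParentMap_of_lt (fun x => H.dist x v) (h1 v rfl) fun x hx => (h2 x hx).2,
    fun x hx => (h2 x hx).1⟩

theorem IsParentMap.isSpanningTree {V : Type*} [Fintype V] {G : SimpleGraph V} (hG : G.Connected)
    {v : V} {φ : V → V} (h : IsParentMap v φ) (hadj : ∀ x, x ≠ v → G.Adj x (φ x)) :
    IsSpanningTree G (parentEdges v φ) := by
  refine (isSpanningTree_iff hG).2 ⟨fun e he => ?_, h.isTree⟩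
  obtain ⟨x, hx, rfl⟩ := mem_parentEdges.1 (Finset.mem_coe.1 he)
  exact hadj x hx

/-- If two parent maps with the same root differ at `x`, then they also differ at `ψ x`, since
`φ (ψ x) = x` and `ψ` has no 2-cycle; so following `ψ` from `x` never leads to the root. -/
theorem IsParentMap.eq_of_parentEdges_eq {V : Type*} [Fintype V] {v : V} {φ ψ : V → V}
    (hφ : IsParentMap v φ) (hψ : IsParentMap v ψ) (h : parentEdges v φ = parentEdges v ψ) :
    φ = ψ := by
  funext x
  by_contra hx
  refine hψ.root_mem (S := {x | φ x ≠ ψ x}) hx (fun y hy => ?_) (hφ.1.trans hψ.1.symm)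
  have hyv : y ≠ v := by
    rintro rfl
    exact hy (hφ.1.trans hψ.1.symm)
  have : s(y, ψ y) ∈ parentEdges v φ := h ▸ mem_parentEdges.2 ⟨y, hyv, rfl⟩
  obtain ⟨z, hzv, hz⟩ := mem_parentEdges.1 this
  rcases Sym2.eq_iff.1 hz with ⟨h1, h2⟩ | ⟨h1, h2⟩
  · subst h1
    exact absurd h2 hy
  · subst h1
    intro heq
    exact hψ.apply_apply_ne hyv (by rw [← heq, h2])

/-- The parent edges of a parent map inside `T` form a maximal acyclic set, hence are all of `T`. -/
theorem IsSpanningTree.exists_parentMap {V : Type*} [Fintype V] {G : SimpleGraph V}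
    (hG : G.Connected) {T : Finset (Sym2 V)} (hT : IsSpanningTree G T) (v : V) :
    ∃ φ, IsParentMap v φ ∧ (∀ x, x ≠ v → G.Adj x (φ x)) ∧ parentEdges v φ = T := by
  have htree := ((isSpanningTree_iff hG).1 hT).2
  obtain ⟨φ, hφ, hadj⟩ := exists_isParentMap htree.connected v
  have hmem : ∀ x, x ≠ v → s(x, φ x) ∈ T := fun x hx =>
    Finset.mem_coe.1 ((SimpleGraph.fromEdgeSet_adj _).1 (hadj x hx)).1
  have hG' : ∀ x, x ≠ v → G.Adj x (φ x) := fun x hx => hT.1.1 (Finset.mem_coe.2 (hmem x hx))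
  have hsub : parentEdges v φ ⊆ T := by
    intro e he
    obtain ⟨x, hx, rfl⟩ := mem_parentEdges.1 he
    exact hmem x hx
  exact ⟨φ, hφ, hG', Finset.Subset.antisymm hsub ((hφ.isSpanningTree hG hG').2 hT.1 hsub)⟩

open scoped Classical in
/-- `parentEdges v` is a bijection from the parent maps along edges of `G` to the spanning trees. The
predicates `P` and `Q` allow restricting both sides, e.g. to trees through a given edge. -/
theorem sum_isParentMap_eq_sum_spanningTrees {V : Type*} [Fintype V] {G : SimpleGraph V}
    (hG : G.Connected) (c : Sym2 V → ℝ) (v : V) (P : (V → V) → Prop) (Q : Finset (Sym2 V) → Prop)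
    (hPQ : ∀ φ, IsParentMap v φ → (P φ ↔ Q (parentEdges v φ))) :
    ∑ φ : V → V with (IsParentMap v φ ∧ (∀ x, x ≠ v → G.Adj x (φ x))) ∧ P φ,
        ∏ x ∈ Finset.univ.erase v, c s(x, φ x) =
      ∑ T ∈ (spanningTrees G).filter Q, ∏ t ∈ T, c t := by
  refine Finset.sum_bij (fun φ _ => parentEdges v φ) ?_ ?_ ?_ ?_
  · intro φ hφ
    obtain ⟨⟨h1, h2⟩, h3⟩ := (Finset.mem_filter.1 hφ).2
    exact Finset.mem_filter.2 ⟨mem_spanningTrees.2 (h1.isSpanningTree hG h2), (hPQ φ h1).1 h3⟩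
  · intro φ hφ ψ hψ h
    exact (Finset.mem_filter.1 hφ).2.1.1.eq_of_parentEdges_eq (Finset.mem_filter.1 hψ).2.1.1 h
  · intro T hT
    obtain ⟨h1, h2⟩ := Finset.mem_filter.1 hT
    obtain ⟨φ, hφ, hadj, rfl⟩ := (mem_spanningTrees.1 h1).exists_parentMap hG v
    exact ⟨φ, Finset.mem_filter.2 ⟨Finset.mem_univ _, ⟨hφ, hadj⟩, (hPQ φ hφ).2 h2⟩, rfl⟩
  · intro φ hφ
    have h1 := (Finset.mem_filter.1 hφ).2.1.1
    rw [parentEdges, Finset.prod_image]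
    intro x hx y _ hxy
    exact h1.injOn_edge (Finset.ne_of_mem_erase hx) hxy

/-! ### The Laplacian and its pseudoinverse -/

open scoped Classical in
/-- The edge weights as a function of two vertices, extended by zero to non-adjacent pairs. -/
noncomputable def conductance {V : Type*} (G : SimpleGraph V) (c : Sym2 V → ℝ) (x y : V) : ℝ :=
  if G.Adj x y then c s(x, y) else 0

theorem conductance_comm {V : Type*} (G : SimpleGraph V) (c : Sym2 V → ℝ) (x y : V) :
    conductance G c x y = conductance G c y x := by
  classical
  unfold conductance
  rw [Sym2.eq_swap]
  exact if_congr (G.adj_comm x y) rfl rfl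

theorem conductance_self {V : Type*} (G : SimpleGraph V) (c : Sym2 V → ℝ) (x : V) :
    conductance G c x x = 0 := by
  simp [conductance]

theorem conductance_of_adj {V : Type*} {G : SimpleGraph V} (c : Sym2 V → ℝ) {x y : V}
    (h : G.Adj x y) : conductance G c x y = c s(x, y) := if_pos h

theorem conductance_of_not_adj {V : Type*} {G : SimpleGraph V} (c : Sym2 V → ℝ) {x y : V}
    (h : ¬ G.Adj x y) : conductance G c x y = 0 := if_neg h

theorem IsWeight.conductance_pos {V : Type*} {G : SimpleGraph V} {c : Sym2 V → ℝ}
    (hc : IsWeight G c) {x y : V} (h : G.Adj x y) : 0 < conductance G c x y := by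
  rw [conductance_of_adj c h]
  exact hc _ h

theorem IsWeight.conductance_nonneg {V : Type*} {G : SimpleGraph V} {c : Sym2 V → ℝ}
    (hc : IsWeight G c) (x y : V) : 0 ≤ conductance G c x y := by
  by_cases h : G.Adj x y
  · exact (hc.conductance_pos h).le
  · rw [conductance_of_not_adj c h]

open scoped Classical in
theorem laplacian_apply {V : Type*} [Fintype V] (G : SimpleGraph V) (c : Sym2 V → ℝ) (x y : V) :
    laplacian G c x y = (if x = y then ∑ w, conductance G c x w else 0) - conductance G c x y := by
  by_cases hxy : x = y
  · subst hxy
    simp only [laplacian, Matrix.of_apply, if_true, conductance_self, sub_zero]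
    rw [SimpleGraph.neighborFinset_eq_filter, Finset.sum_filter]
    simp only [conductance, Sym2.eq_swap]
  · simp only [laplacian, Matrix.of_apply, if_neg hxy, zero_sub, conductance]
    split_ifs <;> simp

theorem laplacian_mulVec_apply {V : Type*} [Fintype V] (G : SimpleGraph V) (c : Sym2 V → ℝ)
    (f : V → ℝ) (x : V) :
    (laplacian G c).mulVec f x = ∑ y, conductance G c x y * (f x - f y) := by
  classical
  simp only [Matrix.mulVec, dotProduct, laplacian_apply, sub_mul, ite_mul, zero_mul,
    Finset.sum_sub_distrib, Finset.sum_ite_eq, Finset.mem_univ, if_true, mul_sub, Finset.sum_mul]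

theorem laplacian_isSymm {V : Type*} [Fintype V] (G : SimpleGraph V) (c : Sym2 V → ℝ) :
    (laplacian G c).IsSymm := by
  classical
  ext x y
  rw [Matrix.transpose_apply, laplacian_apply, laplacian_apply, conductance_comm G c y x]
  by_cases h : x = y
  · subst h; rfl
  · rw [if_neg h, if_neg (Ne.symm h)]

theorem sum_laplacian_row {V : Type*} [Fintype V] (G : SimpleGraph V) (c : Sym2 V → ℝ) (x : V) :
    ∑ y, laplacian G c x y = 0 := by
  have := laplacian_mulVec_apply G c (fun _ => 1) x
  simpa [Matrix.mulVec, dotProduct] using this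

theorem sum_laplacian_col {V : Type*} [Fintype V] (G : SimpleGraph V) (c : Sym2 V → ℝ) (y : V) :
    ∑ x, laplacian G c x y = 0 := by
  rw [← sum_laplacian_row G c y]
  exact Finset.sum_congr rfl fun x _ => (laplacian_isSymm G c).apply y x

/-- The quadratic form of the Laplacian is the Dirichlet energy. -/
theorem laplacian_quadraticForm {V : Type*} [Fintype V] (G : SimpleGraph V) (c : Sym2 V → ℝ)
    (f : V → ℝ) : f ⬝ᵥ (laplacian G c).mulVec f =
      (1 / 2) * ∑ x, ∑ y, conductance G c x y * (f x - f y) ^ 2 := by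
  have h1 : f ⬝ᵥ (laplacian G c).mulVec f =
      ∑ x, ∑ y, f x * (conductance G c x y * (f x - f y)) := by
    simp only [dotProduct, laplacian_mulVec_apply, Finset.mul_sum]
  have h2 : f ⬝ᵥ (laplacian G c).mulVec f =
      ∑ x, ∑ y, f y * (conductance G c x y * (f y - f x)) := by
    rw [h1, Finset.sum_comm]
    simp only [fun x y => conductance_comm G c y x]
  have h3 : ∑ x, ∑ y, conductance G c x y * (f x - f y) ^ 2 =
      ∑ x, ∑ y, f x * (conductance G c x y * (f x - f y)) +
        ∑ x, ∑ y, f y * (conductance G c x y * (f y - f x)) := by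
    simp only [← Finset.sum_add_distrib]
    exact Finset.sum_congr rfl fun x _ => Finset.sum_congr rfl fun y _ => by ring
  rw [h3, ← h1, ← h2]
  ring

theorem IsWeight.laplacian_nonneg {V : Type*} [Fintype V] {G : SimpleGraph V} {c : Sym2 V → ℝ}
    (hc : IsWeight G c) (f : V → ℝ) : 0 ≤ f ⬝ᵥ (laplacian G c).mulVec f := by
  rw [laplacian_quadraticForm]
  have : 0 ≤ ∑ x, ∑ y, conductance G c x y * (f x - f y) ^ 2 :=
    Finset.sum_nonneg fun x _ => Finset.sum_nonneg fun y _ =>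
      mul_nonneg (hc.conductance_nonneg x y) (sq_nonneg _)
  linarith

theorem IsWeight.eq_of_laplacian_eq_zero {V : Type*} [Fintype V] {G : SimpleGraph V}
    (hG : G.Connected) {c : Sym2 V → ℝ} (hc : IsWeight G c) {f : V → ℝ}
    (hf : f ⬝ᵥ (laplacian G c).mulVec f = 0) (x y : V) : f x = f y := by
  rw [laplacian_quadraticForm, mul_eq_zero_iff_left (by norm_num)] at hf
  have hnn : ∀ x y, 0 ≤ conductance G c x y * (f x - f y) ^ 2 := fun x y =>
    mul_nonneg (hc.conductance_nonneg x y) (sq_nonneg _)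
  have hadj : ∀ x y, G.Adj x y → f x = f y := by
    intro x y h
    have h1 := (Finset.sum_eq_zero_iff_of_nonneg fun x _ =>
      Finset.sum_nonneg fun y _ => hnn x y).1 hf x (Finset.mem_univ x)
    have h2 := (Finset.sum_eq_zero_iff_of_nonneg fun y _ => hnn x y).1 h1 y (Finset.mem_univ y)
    rw [mul_eq_zero_iff_left (hc.conductance_pos h).ne'] at h2
    exact sub_eq_zero.1 (pow_eq_zero_iff (two_ne_zero) |>.1 h2)
  obtain ⟨w⟩ := hG.preconnected x y
  induction w with
  | nil => rfl
  | cons h _ ih => exact (hadj _ _ h).trans ih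

theorem averaging_mulVec_apply {V : Type*} [Fintype V] (f : V → ℝ) (x : V) :
    (averaging V).mulVec f x = (∑ y, f y) / Fintype.card V := by
  simp only [Matrix.mulVec, averaging, dotProduct, Matrix.of_apply, ← Finset.mul_sum]
  ring

theorem averaging_isSymm (V : Type*) [Fintype V] : (averaging V).IsSymm := by
  ext x y
  rfl

theorem laplacian_mul_averaging {V : Type*} [Fintype V] (G : SimpleGraph V) (c : Sym2 V → ℝ) :
    laplacian G c * averaging V = 0 := by
  ext x y
  simp [Matrix.mul_apply, averaging, ← Finset.sum_mul, sum_laplacian_row]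

theorem averaging_mul_laplacian {V : Type*} [Fintype V] (G : SimpleGraph V) (c : Sym2 V → ℝ) :
    averaging V * laplacian G c = 0 := by
  ext x y
  simp [Matrix.mul_apply, averaging, ← Finset.mul_sum, sum_laplacian_col]

theorem averaging_mul_self (V : Type*) [Fintype V] [Nonempty V] :
    averaging V * averaging V = averaging V := by
  ext x y
  simp [Matrix.mul_apply, averaging]

theorem isUnit_laplacian_add_averaging {V : Type*} [Fintype V] [DecidableEq V]
    {G : SimpleGraph V} (hG : G.Connected) {c : Sym2 V → ℝ} (hc : IsWeight G c) :
    IsUnit (laplacian G c + averaging V) := by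
  have := hG.nonempty
  have hn : (Fintype.card V : ℝ) ≠ 0 := Nat.cast_ne_zero.2 Fintype.card_ne_zero
  rw [Matrix.isUnit_iff_isUnit_det, isUnit_iff_ne_zero]
  intro hdet
  obtain ⟨f, hf, hMf⟩ := Matrix.exists_mulVec_eq_zero_iff.2 hdet
  have hJ : (averaging V).mulVec f = 0 := by
    have := congrArg (averaging V).mulVec hMf
    rwa [Matrix.mulVec_mulVec, mul_add, averaging_mul_laplacian, averaging_mul_self, zero_add,
      Matrix.mulVec_zero] at this
  have hL : (laplacian G c).mulVec f = 0 := by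
    rwa [Matrix.add_mulVec, hJ, add_zero] at hMf
  have hconst := hc.eq_of_laplacian_eq_zero hG (f := f) (by rw [hL, dotProduct_zero])
  refine hf (funext fun x => ?_)
  have hx := congrFun hJ x
  rw [averaging_mulVec_apply, Finset.sum_congr rfl fun y _ => hconst y x] at hx
  simpa [hn] using hx

theorem laplacian_mul_pinv {V : Type*} [Fintype V] [DecidableEq V]
    {G : SimpleGraph V} (hG : G.Connected) {c : Sym2 V → ℝ} (hc : IsWeight G c) :
    laplacian G c * laplacianPinv G c = 1 - averaging V := by
  have := hG.nonempty
  have hdet := (Matrix.isUnit_iff_isUnit_det _).1 (isUnit_laplacian_add_averaging hG hc)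
  have h1 : averaging V * (laplacian G c + averaging V)⁻¹ = averaging V := by
    calc averaging V * (laplacian G c + averaging V)⁻¹
        = averaging V * (laplacian G c + averaging V) * (laplacian G c + averaging V)⁻¹ := by
          rw [mul_add, averaging_mul_laplacian, averaging_mul_self, zero_add]
      _ = averaging V := Matrix.mul_nonsing_inv_cancel_right _ _ hdet
  rw [laplacianPinv, mul_sub, laplacian_mul_averaging, sub_zero]
  have h2 := Matrix.mul_nonsing_inv _ hdet
  rw [add_mul, h1] at h2
  exact eq_sub_of_add_eq h2

theorem laplacianPinv_isSymm {V : Type*} [Fintype V] [DecidableEq V]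
    (G : SimpleGraph V) (c : Sym2 V → ℝ) : (laplacianPinv G c).IsSymm := by
  rw [laplacianPinv, Matrix.IsSymm, Matrix.transpose_sub, Matrix.transpose_nonsing_inv,
    Matrix.transpose_add, (laplacian_isSymm G c).eq, (averaging_isSymm V).eq]

theorem pinv_mul_laplacian {V : Type*} [Fintype V] [DecidableEq V]
    {G : SimpleGraph V} (hG : G.Connected) {c : Sym2 V → ℝ} (hc : IsWeight G c) :
    laplacianPinv G c * laplacian G c = 1 - averaging V := by
  have := congrArg Matrix.transpose (laplacian_mul_pinv hG hc)
  rwa [Matrix.transpose_mul, Matrix.transpose_sub, Matrix.transpose_one, (laplacian_isSymm G c).eq,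
    (averaging_isSymm V).eq, (laplacianPinv_isSymm G c).eq] at this

theorem sum_pinv_row {V : Type*} [Fintype V] [DecidableEq V]
    {G : SimpleGraph V} (hG : G.Connected) {c : Sym2 V → ℝ} (hc : IsWeight G c) (x : V) :
    ∑ y, laplacianPinv G c x y = 0 := by
  have := hG.nonempty
  have hn : (Fintype.card V : ℝ) ≠ 0 := Nat.cast_ne_zero.2 Fintype.card_ne_zero
  have hdet := (Matrix.isUnit_iff_isUnit_det _).1 (isUnit_laplacian_add_averaging hG hc)
  have h1 : (laplacian G c + averaging V)⁻¹ * averaging V = averaging V := by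
    calc (laplacian G c + averaging V)⁻¹ * averaging V
        = (laplacian G c + averaging V)⁻¹ * ((laplacian G c + averaging V) * averaging V) := by
          rw [add_mul, laplacian_mul_averaging, averaging_mul_self, zero_add]
      _ = averaging V := Matrix.nonsing_inv_mul_cancel_left _ _ hdet
  have h2 : laplacianPinv G c * averaging V = 0 := by
    rw [laplacianPinv, sub_mul, h1, averaging_mul_self, sub_self]
  have h3 := congrFun (congrFun h2 x) x
  simpa [Matrix.mul_apply, averaging, ← Finset.sum_mul, hn] using h3

/-- The diagonal of the pseudoinverse is positive, `L†` being the Gram matrix of the vectors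
`L† e_x` for the Dirichlet energy. -/
theorem pinv_diag_pos {V : Type*} [Fintype V] [DecidableEq V] [Nontrivial V]
    {G : SimpleGraph V} (hG : G.Connected) {c : Sym2 V → ℝ} (hc : IsWeight G c) (x : V) :
    0 < laplacianPinv G c x x := by
  have hn : (Fintype.card V : ℝ) ≠ 0 := Nat.cast_ne_zero.2 Fintype.card_ne_zero
  set f : V → ℝ := fun y => laplacianPinv G c y x
  have hLf : ∀ y, (laplacian G c).mulVec f y = (if y = x then 1 else 0) - 1 / Fintype.card V := by
    intro y
    have := congrFun (congrFun (laplacian_mul_pinv hG hc) y) x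
    rwa [Matrix.mul_apply, Matrix.sub_apply, Matrix.one_apply] at this
  have hsum : ∑ y, f y = 0 := by
    rw [← sum_pinv_row hG hc x]
    exact Finset.sum_congr rfl fun y _ => (laplacianPinv_isSymm G c).apply x y
  have hE : f ⬝ᵥ (laplacian G c).mulVec f = laplacianPinv G c x x := by
    simp only [dotProduct, hLf, mul_sub, Finset.sum_sub_distrib, ← Finset.sum_mul, hsum]
    simp [f]
  refine lt_of_le_of_ne (hE ▸ hc.laplacian_nonneg f) fun h0 => ?_
  have hconst := hc.eq_of_laplacian_eq_zero hG (f := f) (by rw [hE, ← h0])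
  obtain ⟨y, hy⟩ := exists_ne x
  have h1 := hLf y
  rw [laplacian_mulVec_apply, Finset.sum_eq_zero fun z _ => by rw [hconst y z]; ring,
    if_neg hy] at h1
  have : (1 : ℝ) / Fintype.card V ≠ 0 := one_div_ne_zero hn
  exact this (by linarith)

/-! ### Relative resistances and effective resistances -/

open scoped Classical in
/-- The matrix-tree theorem for conductances restricted to the pairs `(x, y)` with `R x y`, where `R`
holds along a parent map exactly when the corresponding tree satisfies `Q`. -/
theorem det_groundedLaplacian_eq_sum_spanningTrees {V : Type*} [Fintype V] [hV : DecidableEq V]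
    {G : SimpleGraph V}
    (hG : G.Connected) (c : Sym2 V → ℝ) (v : V) (a : V → V → ℝ) (R : V → V → Prop)
    (ha : ∀ x y, a x y = if R x y then conductance G c x y else 0)
    (Q : Finset (Sym2 V) → Prop)
    (hRQ : ∀ φ, IsParentMap v φ → ((∀ x, x ≠ v → R x (φ x)) ↔ Q (parentEdges v φ))) :
    (groundedLaplacian a v).det = ∑ T ∈ (spanningTrees G).filter Q, ∏ t ∈ T, c t := by
  obtain rfl : hV = fun x y => Classical.propDecidable (x = y) := Subsingleton.elim _ _
  rw [det_groundedLaplacian, ← sum_isParentMap_eq_sum_spanningTrees hG c v _ Q hRQ,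
    ← Finset.filter_filter, ← Finset.filter_filter, Finset.sum_filter, Finset.sum_filter,
    Finset.sum_filter, Finset.sum_filter]
  refine Finset.sum_congr rfl fun φ _ => ?_
  by_cases h : ∀ x, x ≠ v → G.Adj x (φ x) ∧ R x (φ x)
  · rw [if_pos fun x hx => (h x hx).1, if_pos fun x hx => (h x hx).2]
    refine if_congr Iff.rfl (Finset.prod_congr rfl fun x hx => ?_) rfl
    have := h x (Finset.ne_of_mem_erase hx)
    rw [ha, if_pos this.2, conductance_of_adj c this.1]
  · have h0 : ∏ x ∈ Finset.univ.erase v, a x (φ x) = 0 := by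
      push Not at h
      obtain ⟨x, hx, hxR⟩ := h
      refine Finset.prod_eq_zero (Finset.mem_erase.2 ⟨hx, Finset.mem_univ x⟩) ?_
      rw [ha]
      by_cases hadj : G.Adj x (φ x)
      · rw [if_neg (hxR hadj)]
      · rw [conductance_of_not_adj c hadj, ite_self]
    rw [h0, ite_self]
    split_ifs with h1 h2 h3
    · exact absurd (fun x hx => ⟨h2 x hx, h3 x hx⟩) h
    all_goals rfl

theorem sum_spanningTrees_pos {V : Type*} [Fintype V] {G : SimpleGraph V}
    (hG : G.Connected) {c : Sym2 V → ℝ} (hc : IsWeight G c) :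
    0 < ∑ T ∈ spanningTrees G, ∏ t ∈ T, c t := by
  obtain ⟨v⟩ := hG.nonempty
  obtain ⟨φ, hφ, hadj⟩ := exists_isParentMap hG v
  refine Finset.sum_pos (fun T hT => Finset.prod_pos fun t ht => hc t ?_)
    ⟨_, mem_spanningTrees.2 (hφ.isSpanningTree hG hadj)⟩
  exact (mem_spanningTrees.1 hT).1.1 (Finset.mem_coe.2 ht)

theorem groundedLaplacian_mulVec_apply {V : Type*} [Fintype V] [DecidableEq V] {a : V → V → ℝ}
    {v x : V} (hx : x ≠ v) (f : V → ℝ) :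
    (groundedLaplacian a v).mulVec f x = ∑ y, a x y * (f x - f y) := by
  rw [Matrix.mulVec, groundedLaplacian_of_ne a hx, sum_dotProduct]
  refine Finset.sum_congr rfl fun y _ => ?_
  rw [smul_dotProduct, sub_dotProduct]
  simp

/-- Kirchhoff's theorem. Let `g` be the potential of a unit current from `u` to `v`, grounded at `v`.
By Cramer's rule, its value at `u` is a quotient of two minors of the Laplacian, which the matrix-tree
theorem for trees rooted at `v` evaluates: the trees containing `uv` are those in which `v` is the
parent of `u`. -/
theorem relativeResistance_eq {V : Type*} [Fintype V] [DecidableEq V] {G : SimpleGraph V}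
    (hG : G.Connected) {c : Sym2 V → ℝ} (hc : IsWeight G c) {u v : V} (huv : G.Adj u v) :
    relativeResistance G c s(u, v) = conductance G c u v * resistanceMatrix G c u v := by
  classical
  have hne : u ≠ v := huv.ne
  set a := conductance G c
  set N := groundedLaplacian a v
  have hden : N.det = ∑ T ∈ spanningTrees G, ∏ t ∈ T, c t := by
    have := det_groundedLaplacian_eq_sum_spanningTrees hG c v a (fun _ _ => True)
      (fun x y => by simp [a]) (fun _ => True) (fun φ _ => by simp)
    rw [Finset.filter_true] at this
    exact this
  have hnum : a u v * (N.updateRow u (Pi.single u 1)).det =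
      ∑ T ∈ (spanningTrees G).filter (fun T => s(u, v) ∈ T), ∏ t ∈ T, c t := by
    have h1 := det_groundedLaplacian_eq_sum_spanningTrees hG c v
      (fun x y => if (x = u → y = v) then a x y else 0) (fun x y => x = u → y = v)
      (fun x y => by congr!) (fun T => s(u, v) ∈ T) (fun φ hφ => by
        rw [mem_parentEdges]
        constructor
        · intro h
          exact ⟨u, hne, by rw [h u hne rfl]⟩
        · rintro ⟨x, hx, hxe⟩ y hy rfl
          rcases Sym2.eq_iff.1 hxe with ⟨h1, h2⟩ | ⟨h1, h2⟩
          · rw [← h2, h1]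
          · exact absurd h1 hx)
    refine Eq.trans ?_ (h1.trans (by congr!))
    -- Row `u` restricted to the parent `v` is `a u v • (e_u - e_v)`, and subtracting `e_v` does not
    -- matter, this being row `v`.
    have h2 : N.updateRow u (a u v • (Pi.single u 1 + (-1 : ℝ) • Pi.single v 1)) =
        groundedLaplacian (fun x y => if (x = u → y = v) then a x y else 0) v := by
      funext x
      by_cases hxu : x = u
      · subst hxu
        rw [Matrix.updateRow_self, groundedLaplacian_of_ne _ hne,
          Finset.sum_eq_single v (fun y _ hy => by simp [hy]) (by simp)]
        simp [sub_eq_add_neg]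
      · rw [Matrix.updateRow_ne hxu]
        by_cases hxv : x = v
        · subst hxv
          exact (groundedLaplacian_root a x).trans (groundedLaplacian_root _ x).symm
        · refine (groundedLaplacian_of_ne a hxv).trans
            (Eq.trans ?_ (groundedLaplacian_of_ne _ hxv).symm)
          simp [hxu]
    have h3 : (N.updateRow u (Pi.single v 1)).det = 0 := by
      rw [← groundedLaplacian_root a v]
      exact Matrix.det_updateRow_eq_zero hne.symm
    have h4 : (groundedLaplacian (fun x y => if (x = u → y = v) then a x y else 0) v).det =
        a u v * (N.updateRow u (Pi.single u 1)).det := by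
      rw [← h2, Matrix.det_updateRow_smul, Matrix.det_updateRow_add, Matrix.det_updateRow_smul, h3]
      ring
    exact h4.symm
  set P := laplacianPinv G c
  set g : V → ℝ := fun x => (P x u - P x v) - (P v u - P v v)
  have hLg : ∀ x, ∑ y, a x y * (g x - g y) =
      (if x = u then 1 else 0) - (if x = v then (1 : ℝ) else 0) := by
    intro x
    have hP : ∀ w, ∑ y, a x y * (P x w - P y w) =
        (if x = w then 1 else 0) - 1 / Fintype.card V := by
      intro w
      rw [← laplacian_mulVec_apply G c (fun y => P y w)]
      have := congrFun (congrFun (laplacian_mul_pinv hG hc) x) w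
      rwa [Matrix.mul_apply, Matrix.sub_apply, Matrix.one_apply] at this
    calc ∑ y, a x y * (g x - g y)
        = ∑ y, a x y * (P x u - P y u) - ∑ y, a x y * (P x v - P y v) := by
          rw [← Finset.sum_sub_distrib]
          exact Finset.sum_congr rfl fun y _ => by simp only [g]; ring
      _ = _ := by rw [hP, hP]; ring
  have hNg : N.mulVec g = Pi.single u 1 := by
    funext x
    by_cases hx : x = v
    · subst hx
      have hNx : N x = Pi.single x 1 := groundedLaplacian_root a x
      rw [Matrix.mulVec, hNx]
      simp [g, hne.symm]
    · rw [groundedLaplacian_mulVec_apply hx, hLg, if_neg hx, sub_zero, Pi.single_apply]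
  have hcramer : N.det * g u = (N.updateRow u (Pi.single u 1)).det := by
    have := congrFun (congrArg (Matrix.adjugate N).mulVec hNg) u
    rw [Matrix.mulVec_mulVec, Matrix.adjugate_mul, Matrix.smul_mulVec, Matrix.one_mulVec] at this
    rw [← Matrix.adjugate_apply]
    simpa using this
  have hgu : g u = resistanceMatrix G c u v := by
    have := (laplacianPinv_isSymm G c).apply u v
    simp only [g, P, resistanceMatrix, Matrix.of_apply, this]
    ring
  rw [relativeResistance, ← hden, ← hgu,
    div_eq_iff (by rw [hden]; exact (sum_spanningTrees_pos hG hc).ne')]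
  rw [mul_assoc, mul_comm (g u), hcramer, hnum]
  congr!

/-! ### Inverting the resistance matrix -/

/-- The vector `p = ½ L d + (1/n) 𝟏`, where `d` is the diagonal of the pseudoinverse. It is the
vector of resistance curvatures, and the resistance matrix maps it to a constant vector. -/
noncomputable def curvatureVector {V : Type*} [Fintype V] [DecidableEq V] (G : SimpleGraph V)
    (c : Sym2 V → ℝ) (x : V) : ℝ :=
  (1 / 2) * (laplacian G c).mulVec (laplacianPinv G c).diag x + 1 / Fintype.card V

/-- The constant value `τ` taken by the image of the curvature vector under the resistance matrix;
the entries of the inverse resistance matrix sum to `1 / τ`. -/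
noncomputable def curvaturePotential {V : Type*} [Fintype V] [DecidableEq V] (G : SimpleGraph V)
    (c : Sym2 V → ℝ) : ℝ :=
  (laplacianPinv G c).diag ⬝ᵥ curvatureVector G c +
    (∑ x, (laplacianPinv G c).diag x) / Fintype.card V

theorem curvature_eq_curvatureVector {V : Type*} [Fintype V] [DecidableEq V] {G : SimpleGraph V}
    (hG : G.Connected) {c : Sym2 V → ℝ} (hc : IsWeight G c) (v : V) :
    curvature G c v = curvatureVector G c v := by
  classical
  have hsum : curvature G c v =
      1 - (1 / 2) * ∑ u, conductance G c v u * resistanceMatrix G c v u := by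
    rw [curvature, SimpleGraph.neighborFinset_eq_filter, Finset.sum_filter]
    congr 2
    refine Finset.sum_congr rfl fun u _ => ?_
    split_ifs with h
    · rw [Sym2.eq_swap, relativeResistance_eq hG hc h]
    · rw [conductance_of_not_adj c h, zero_mul]
  have hP : ∑ u, conductance G c v u * (laplacianPinv G c v v - laplacianPinv G c u v) =
      1 - 1 / Fintype.card V := by
    rw [← laplacian_mulVec_apply G c (fun y => laplacianPinv G c y v)]
    have := congrFun (congrFun (laplacian_mul_pinv hG hc) v) v
    rwa [Matrix.mul_apply, Matrix.sub_apply, Matrix.one_apply_eq] at this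
  have hsplit : ∑ u, conductance G c v u * resistanceMatrix G c v u =
      2 * ∑ u, conductance G c v u * (laplacianPinv G c v v - laplacianPinv G c u v) -
        (laplacian G c).mulVec (laplacianPinv G c).diag v := by
    rw [laplacian_mulVec_apply, Finset.mul_sum, ← Finset.sum_sub_distrib]
    refine Finset.sum_congr rfl fun u _ => ?_
    rw [resistanceMatrix, Matrix.of_apply, ← (laplacianPinv_isSymm G c).apply v u, Matrix.diag_apply,
      Matrix.diag_apply]
    ring
  rw [hsum, hsplit, hP, curvatureVector]
  ring

theorem sum_laplacian_mulVec {V : Type*} [Fintype V] (G : SimpleGraph V) (c : Sym2 V → ℝ)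
    (f : V → ℝ) : ∑ x, (laplacian G c).mulVec f x = 0 := by
  simp only [Matrix.mulVec, dotProduct]
  rw [Finset.sum_comm]
  simp [← Finset.sum_mul, sum_laplacian_col]

theorem sum_curvatureVector {V : Type*} [Fintype V] [DecidableEq V] [Nonempty V]
    (G : SimpleGraph V) (c : Sym2 V → ℝ) : ∑ x, curvatureVector G c x = 1 := by
  simp [curvatureVector, Finset.sum_add_distrib, ← Finset.mul_sum, sum_laplacian_mulVec]

theorem laplacian_mul_resistanceMatrix_apply {V : Type*} [Fintype V] [DecidableEq V]
    {G : SimpleGraph V} (hG : G.Connected) {c : Sym2 V → ℝ} (hc : IsWeight G c) (x y : V) :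
    (laplacian G c * resistanceMatrix G c) x y =
      2 * curvatureVector G c x - 2 * (1 : Matrix V V ℝ) x y := by
  have hP := congrFun (congrFun (laplacian_mul_pinv hG hc) x) y
  rw [Matrix.mul_apply, Matrix.sub_apply, averaging, Matrix.of_apply] at hP
  have hd : ∑ z, laplacian G c x z * laplacianPinv G c z z =
      (laplacian G c).mulVec (laplacianPinv G c).diag x := rfl
  have h0 : ∑ z, laplacian G c x z * laplacianPinv G c y y = 0 := by
    rw [← Finset.sum_mul, sum_laplacian_row, zero_mul]
  have : (laplacian G c * resistanceMatrix G c) x y =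
      ∑ z, laplacian G c x z * laplacianPinv G c z z +
      ∑ z, laplacian G c x z * laplacianPinv G c y y -
      2 * ∑ z, laplacian G c x z * laplacianPinv G c z y := by
    rw [Matrix.mul_apply, Finset.mul_sum, ← Finset.sum_add_distrib, ← Finset.sum_sub_distrib]
    refine Finset.sum_congr rfl fun z _ => ?_
    rw [resistanceMatrix, Matrix.of_apply]
    ring
  rw [this, hd, h0, hP, curvatureVector]
  ring

theorem resistanceMatrix_isSymm {V : Type*} [Fintype V] [DecidableEq V]
    (G : SimpleGraph V) (c : Sym2 V → ℝ) : (resistanceMatrix G c).IsSymm := by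
  ext x y
  simp only [resistanceMatrix, Matrix.transpose_apply, Matrix.of_apply,
    (laplacianPinv_isSymm G c).apply x y]
  ring

theorem resistanceMatrix_diag {V : Type*} [Fintype V] [DecidableEq V]
    (G : SimpleGraph V) (c : Sym2 V → ℝ) (x : V) : resistanceMatrix G c x x = 0 := by
  simp only [resistanceMatrix, Matrix.of_apply]
  ring

theorem resistanceMatrix_mulVec_curvatureVector {V : Type*} [Fintype V] [DecidableEq V]
    {G : SimpleGraph V} (hG : G.Connected) {c : Sym2 V → ℝ} (hc : IsWeight G c) (x : V) :
    (resistanceMatrix G c).mulVec (curvatureVector G c) x = curvaturePotential G c := by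
  have := hG.nonempty
  set p := curvatureVector G c with hp
  set P := laplacianPinv G c
  have hPp : ∑ y, P x y * p y = (1 / 2) * (P x x - (∑ y, P.diag y) / Fintype.card V) := by
    have h1 : ∑ y, P x y * (laplacian G c).mulVec P.diag y =
        P x x - (∑ y, P.diag y) / Fintype.card V := by
      have := congrArg (fun M : Matrix V V ℝ => M.mulVec P.diag x) (pinv_mul_laplacian hG hc)
      simp only [← Matrix.mulVec_mulVec, Matrix.sub_mulVec, Matrix.one_mulVec, Pi.sub_apply,
        averaging_mulVec_apply] at this
      exact this
    simp only [hp, curvatureVector, mul_add, Finset.sum_add_distrib, ← Finset.sum_mul]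
    rw [sum_pinv_row hG hc, zero_mul, add_zero, ← h1, Finset.mul_sum]
    exact Finset.sum_congr rfl fun y _ => by ring
  have hsplit : (resistanceMatrix G c).mulVec p x =
      P x x * ∑ y, p y + P.diag ⬝ᵥ p - 2 * ∑ y, P x y * p y := by
    simp only [Matrix.mulVec, dotProduct, Finset.mul_sum, ← Finset.sum_add_distrib,
      ← Finset.sum_sub_distrib]
    refine Finset.sum_congr rfl fun y _ => ?_
    rw [resistanceMatrix, Matrix.of_apply, Matrix.diag_apply]
    ring
  rw [hsplit, hPp, hp, sum_curvatureVector, curvaturePotential]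
  ring

/-- One has `τ = ½ dᵀ L d + (2/n) tr L†`. -/
theorem curvaturePotential_pos {V : Type*} [Fintype V] [DecidableEq V] [Nontrivial V]
    {G : SimpleGraph V} (hG : G.Connected) {c : Sym2 V → ℝ} (hc : IsWeight G c) :
    0 < curvaturePotential G c := by
  set d := (laplacianPinv G c).diag with hd
  have h1 : d ⬝ᵥ curvatureVector G c =
      (1 / 2) * (d ⬝ᵥ (laplacian G c).mulVec d) + (∑ x, d x) / Fintype.card V := by
    simp only [dotProduct, curvatureVector, ← hd, Finset.mul_sum, Finset.sum_div,
      ← Finset.sum_add_distrib]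
    exact Finset.sum_congr rfl fun x _ => by ring
  have h2 : 0 < (∑ x, d x) / Fintype.card V :=
    div_pos (Finset.sum_pos (fun x _ => pinv_diag_pos hG hc x) Finset.univ_nonempty)
      (Nat.cast_pos.2 Fintype.card_pos)
  have h3 := hc.laplacian_nonneg d
  rw [curvaturePotential, h1]
  linarith

/-- The matrix `p pᵀ - (τ/2) L`, which is `τ` times the inverse resistance matrix. -/
noncomputable def scaledInverse {V : Type*} [Fintype V] [DecidableEq V] (G : SimpleGraph V)
    (c : Sym2 V → ℝ) : Matrix V V ℝ :=
  Matrix.vecMulVec (curvatureVector G c) (curvatureVector G c) -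
    (curvaturePotential G c / 2) • laplacian G c

/-- Fiedler's identity. -/
theorem scaledInverse_mul_resistanceMatrix {V : Type*} [Fintype V] [DecidableEq V]
    {G : SimpleGraph V} (hG : G.Connected) {c : Sym2 V → ℝ} (hc : IsWeight G c) :
    scaledInverse G c * resistanceMatrix G c = curvaturePotential G c • 1 := by
  ext x y
  have h := resistanceMatrix_mulVec_curvatureVector hG hc y
  rw [← (resistanceMatrix_isSymm G c).eq, Matrix.mulVec_transpose] at h
  rw [scaledInverse, sub_mul, Matrix.sub_apply, Matrix.smul_mul, Matrix.smul_apply, smul_eq_mul,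
    laplacian_mul_resistanceMatrix_apply hG hc, Matrix.vecMulVec_mul, Matrix.vecMulVec_apply, h,
    Matrix.smul_apply, smul_eq_mul]
  ring

theorem resistanceMatrix_inv {V : Type*} [Fintype V] [DecidableEq V] [Nontrivial V]
    {G : SimpleGraph V} (hG : G.Connected) {c : Sym2 V → ℝ} (hc : IsWeight G c) :
    (resistanceMatrix G c)⁻¹ = (curvaturePotential G c)⁻¹ • scaledInverse G c := by
  refine Matrix.inv_eq_left_inv ?_
  rw [Matrix.smul_mul, scaledInverse_mul_resistanceMatrix hG hc, smul_smul,
    inv_mul_cancel₀ (curvaturePotential_pos hG hc).ne', one_smul]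

theorem sum_scaledInverse_col {V : Type*} [Fintype V] [DecidableEq V] [Nonempty V]
    (G : SimpleGraph V) (c : Sym2 V → ℝ) (y : V) :
    ∑ x, scaledInverse G c x y = curvatureVector G c y := by
  simp [scaledInverse, Matrix.vecMulVec_apply, ← Finset.sum_mul, ← Finset.mul_sum,
    sum_curvatureVector, sum_laplacian_col]

theorem scaledInverse_isSymm {V : Type*} [Fintype V] [DecidableEq V]
    (G : SimpleGraph V) (c : Sym2 V → ℝ) : (scaledInverse G c).IsSymm := by
  ext x y
  simp only [scaledInverse, Matrix.transpose_apply, Matrix.sub_apply, Matrix.smul_apply,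
    Matrix.vecMulVec_apply, (laplacian_isSymm G c).apply x y]
  ring

theorem IsNormalized.curvaturePotential_eq_one {V : Type*} [Fintype V] [DecidableEq V]
    [Nontrivial V] {G : SimpleGraph V} (hG : G.Connected) {c : Sym2 V → ℝ} (hc : IsWeight G c)
    (hn : IsNormalized G c) : curvaturePotential G c = 1 := by
  rw [IsNormalized, resistanceMatrix_inv hG hc] at hn
  simp only [Matrix.smul_apply] at hn
  rw [Finset.sum_comm] at hn
  simp only [smul_eq_mul, ← Finset.mul_sum, sum_scaledInverse_col,
    sum_curvatureVector, mul_one] at hn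
  exact inv_eq_one.1 hn

theorem IsNormalized.inv_eq {V : Type*} [Fintype V] [DecidableEq V]
    [Nontrivial V] {G : SimpleGraph V} (hG : G.Connected) {c : Sym2 V → ℝ} (hc : IsWeight G c)
    (hn : IsNormalized G c) : (resistanceMatrix G c)⁻¹ = scaledInverse G c := by
  rw [resistanceMatrix_inv hG hc, hn.curvaturePotential_eq_one hG hc, inv_one, one_smul]

/-! ### The semialgebraic description -/

/-- This holds for all weights `c`, normalized or not: `scaledInverse G c` is the inverse resistance
matrix of the normalized multiple of `c`. -/
theorem scaledInverse_mem_semialgebraicSet {V : Type*} [Fintype V] [DecidableEq V] [Nontrivial V]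
    {G : SimpleGraph V} (hG : G.Connected) {c : Sym2 V → ℝ} (hc : IsWeight G c) :
    scaledInverse G c ∈ semialgebraicSet G := by
  have hτ := curvaturePotential_pos hG hc
  have hmul : ((curvaturePotential G c)⁻¹ • resistanceMatrix G c) * scaledInverse G c = 1 := by
    rw [mul_eq_one_comm, Matrix.mul_smul, scaledInverse_mul_resistanceMatrix hG hc, smul_smul,
      inv_mul_cancel₀ hτ.ne', one_smul]
  have hrow : ∀ x, ∑ y, scaledInverse G c x y = curvatureVector G c x := by
    intro x
    rw [← sum_scaledInverse_col G c x]
    exact Finset.sum_congr rfl fun y _ => (scaledInverse_isSymm G c).apply y x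
  have hentry : ∀ u v, u ≠ v → scaledInverse G c u v =
      curvatureVector G c v * curvatureVector G c u +
        curvaturePotential G c / 2 * conductance G c u v := by
    intro u v huv
    simp only [scaledInverse, Matrix.sub_apply, Matrix.vecMulVec_apply, Matrix.smul_apply,
      smul_eq_mul]
    rw [laplacian_apply, if_neg huv]
    ring
  refine ⟨⟨scaledInverse_isSymm G c, IsUnit.of_mul_eq_one_right _ hmul⟩, ?_, fun v => ?_,
    fun u v huv hadj => ?_, fun u v hadj => ?_⟩
  · simp only [hrow, sum_curvatureVector]
  · rw [Matrix.inv_eq_left_inv hmul, Matrix.smul_apply, resistanceMatrix_diag, smul_zero]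
  · rw [sum_scaledInverse_col, hrow, hentry u v huv, conductance_of_not_adj c hadj, mul_zero,
      add_zero]
  · rw [sum_scaledInverse_col, hrow, hentry u v hadj.ne]
    have := mul_pos (half_pos hτ) (hc.conductance_pos hadj)
    linarith

/-- With `p = K 𝟏`, the weights are read off from `2 (p pᵀ - K)`, which is a Laplacian `L` of `G`. Then
`L K⁻¹ = 2 (p 𝟏ᵀ - I)`, so `K⁻¹ + 2 L†` is a sum of a matrix with constant rows and one with constant
columns, and this determines `K⁻¹` because its diagonal vanishes. -/
theorem exists_weight_of_mem_semialgebraicSet {V : Type*} [Fintype V] [DecidableEq V]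
    {G : SimpleGraph V} (hG : G.Connected) {K : Matrix V V ℝ} (hK : K ∈ semialgebraicSet G) :
    ∃ c, IsWeight G c ∧ resistanceMatrix G c = K⁻¹ := by
  obtain ⟨⟨hsymm, hunit⟩, hsum, hdiag, hnadj, hadj⟩ := hK
  have hdet := (Matrix.isUnit_iff_isUnit_det _).1 hunit
  set p : V → ℝ := fun x => ∑ w, K x w with hp
  have hcol : ∀ x, ∑ w, K w x = p x := fun x =>
    Finset.sum_congr rfl fun w _ => hsymm.apply x w
  have hp1 : ∑ x, p x = 1 := hsum
  let c : Sym2 V → ℝ := Sym2.lift ⟨fun x y => 2 * (K x y - p x * p y), fun x y => by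
    beta_reduce
    rw [hsymm.apply, mul_comm (p x)]⟩
  have hcw : ∀ x y, c s(x, y) = 2 * (K x y - p x * p y) := fun x y => rfl
  have hc : IsWeight G c := by
    intro e
    induction e with
    | _ x y =>
      intro he
      have := hadj x y he
      rw [hcol] at this
      rw [hcw]
      have h2 : K x y > p y * p x := this
      linarith [mul_comm (p x) (p y)]
  have hcond : ∀ x y, x ≠ y → conductance G c x y = 2 * (K x y - p x * p y) := by
    intro x y hxy
    by_cases h : G.Adj x y
    · rw [conductance_of_adj c h, hcw]
    · have := hnadj x y hxy h
      rw [hcol] at this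
      have h2 : K x y = p y * p x := this
      rw [conductance_of_not_adj c h, h2]
      ring
  have hL : ∀ x y, laplacian G c x y = 2 * (p x * p y - K x y) := by
    intro x y
    by_cases hxy : x = y
    · subst hxy
      have h1 := sum_laplacian_row G c x
      have h2 : ∑ y, 2 * (p x * p y - K x y) = 0 := by
        rw [← Finset.mul_sum, Finset.sum_sub_distrib, ← Finset.mul_sum, hp1, mul_one, sub_self,
          mul_zero]
      rw [← h1, ← Finset.add_sum_erase _ _ (Finset.mem_univ x),
        ← Finset.add_sum_erase _ (fun y => laplacian G c x y) (Finset.mem_univ x)] at h2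
      have h3 : ∑ y ∈ Finset.univ.erase x, 2 * (p x * p y - K x y) =
          ∑ y ∈ Finset.univ.erase x, laplacian G c x y := by
        refine Finset.sum_congr rfl fun y hy => ?_
        have hne := (Finset.ne_of_mem_erase hy).symm
        rw [laplacian_apply, if_neg hne, hcond x y hne]
        ring
      linarith
    · rw [laplacian_apply, if_neg hxy, hcond x y hxy]
      ring
  refine ⟨c, hc, ?_⟩
  set W := K⁻¹
  have hKW : K * W = 1 := Matrix.mul_nonsing_inv _ hdet
  have hWsymm : ∀ x y, W x y = W y x := by
    have : W.IsSymm := by rw [Matrix.IsSymm, Matrix.transpose_nonsing_inv, hsymm.eq]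
    exact fun x y => this.apply y x
  have hpW : ∀ y, ∑ z, p z * W z y = 1 := by
    intro y
    have h1 : ∑ z, p z * W z y = ∑ w, (K * W) w y := by
      simp only [Matrix.mul_apply]
      rw [Finset.sum_comm]
      simp only [← Finset.sum_mul, hcol]
    rw [h1, hKW]
    simp [Matrix.one_apply]
  have hLW : ∀ x y, (laplacian G c * W) x y = 2 * p x - 2 * (1 : Matrix V V ℝ) x y := by
    intro x y
    rw [← hKW, Matrix.mul_apply, Matrix.mul_apply]
    have : ∑ z, laplacian G c x z * W z y =
        2 * (p x * ∑ z, p z * W z y) - 2 * ∑ z, K x z * W z y := by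
      simp only [Finset.mul_sum, ← Finset.sum_sub_distrib]
      exact Finset.sum_congr rfl fun z _ => by rw [hL]; ring
    rw [this, hpW, mul_one]
  set P := laplacianPinv G c
  obtain ⟨a, b, hW⟩ : ∃ a b : V → ℝ, ∀ x y, W x y = a y + b x - 2 * P x y := by
    refine ⟨fun y => (∑ z, W z y) / Fintype.card V, fun x => 2 * ∑ z, P x z * p z,
      fun x y => ?_⟩
    have h1 : (P * laplacian G c * W) x y = W x y - (∑ z, W z y) / Fintype.card V := by
      rw [pinv_mul_laplacian hG hc, sub_mul, one_mul, Matrix.sub_apply]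
      congr 1
      exact averaging_mulVec_apply (fun z => W z y) x
    have h2 : (P * laplacian G c * W) x y = 2 * ∑ z, P x z * p z - 2 * P x y := by
      have h3 : P x y = ∑ z, P x z * (1 : Matrix V V ℝ) z y := by
        rw [← Matrix.mul_apply, mul_one]
      rw [mul_assoc, Matrix.mul_apply, h3]
      simp only [Finset.mul_sum, ← Finset.sum_sub_distrib]
      exact Finset.sum_congr rfl fun z _ => by rw [hLW]; ring
    linarith
  ext x y
  have h1 := hW x y
  have h2 := hW y x
  have h3 := hW x x
  have h4 := hW y y
  rw [hdiag] at h3 h4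
  have h5 : P y x = P x y := (laplacianPinv_isSymm G c).apply x y
  rw [hWsymm y x, h5] at h2
  rw [resistanceMatrix, Matrix.of_apply]
  change P x x + P y y - 2 * P x y = W x y
  linarith

theorem inverseResistanceSet_eq_semialgebraicSet {V : Type*} [Fintype V] [DecidableEq V]
    [Nontrivial V] {G : SimpleGraph V} (hG : G.Connected) :
    inverseResistanceSet G = semialgebraicSet G := by
  ext K
  constructor
  · rintro ⟨c, hc, hn, rfl⟩
    rw [hn.inv_eq hG hc]
    exact scaledInverse_mem_semialgebraicSet hG hc
  · intro hK
    obtain ⟨c, hc, hΩ⟩ := exists_weight_of_mem_semialgebraicSet hG hK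
    have hinv : (resistanceMatrix G c)⁻¹ = K := by
      rw [hΩ, Matrix.nonsing_inv_nonsing_inv _ ((Matrix.isUnit_iff_isUnit_det _).1 hK.1.2)]
    refine ⟨c, hc, ?_, hinv.symm⟩
    rw [IsNormalized, hinv]
    exact hK.2.1

theorem IsNormalized.curvature_eq {V : Type*} [Fintype V] [DecidableEq V]
    [Nontrivial V] {G : SimpleGraph V} (hG : G.Connected) {c : Sym2 V → ℝ} (hc : IsWeight G c)
    (hn : IsNormalized G c) (v : V) :
    curvature G c v = ∑ u, (resistanceMatrix G c)⁻¹ u v := by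
  rw [curvature_eq_curvatureVector hG hc, hn.inv_eq hG hc, sum_scaledInverse_col]

end ResistanceCurvature

theorem mainTheorem11 {V : Type*} [Fintype V] [DecidableEq V] [Nontrivial V]
    (G : SimpleGraph V) (hG : G.Connected) :
    (ResistanceCurvature.IsRN G ↔
      (ResistanceCurvature.inverseResistanceSet G ∩
        ⋂ v : V, ResistanceCurvature.halfspace v).Nonempty) ∧
    (ResistanceCurvature.IsRP G ↔
      (ResistanceCurvature.inverseResistanceSet G ∩
        ⋂ v : V, ResistanceCurvature.openHalfspace v).Nonempty) ∧
    ResistanceCurvature.inverseResistanceSet G = ResistanceCurvature.semialgebraicSet G ∧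
    (∀ c : Sym2 V → ℝ, ResistanceCurvature.IsWeight G c → ResistanceCurvature.IsNormalized G c →
      ∀ v : V, ResistanceCurvature.curvature G c v =
        ∑ u, (ResistanceCurvature.resistanceMatrix G c)⁻¹ u v) := by
  open ResistanceCurvature in
  refine ⟨⟨?_, ?_⟩, ⟨?_, ?_⟩, inverseResistanceSet_eq_semialgebraicSet hG,
    fun c hc hn v => hn.curvature_eq hG hc v⟩
  · rintro ⟨c, hc, hp⟩
    have hK := scaledInverse_mem_semialgebraicSet hG hc
    refine ⟨scaledInverse G c, inverseResistanceSet_eq_semialgebraicSet hG ▸ hK,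
      Set.mem_iInter.2 fun v => ⟨hK.1, ?_⟩⟩
    rw [sum_scaledInverse_col, ← curvature_eq_curvatureVector hG hc]
    exact hp v
  · rintro ⟨_, ⟨c, hc, hn, rfl⟩, hp⟩
    refine ⟨c, hc, fun v => ?_⟩
    rw [hn.curvature_eq hG hc]
    exact (Set.mem_iInter.1 hp v).2
  · rintro ⟨c, hc, hp⟩
    have hK := scaledInverse_mem_semialgebraicSet hG hc
    refine ⟨scaledInverse G c, inverseResistanceSet_eq_semialgebraicSet hG ▸ hK,
      Set.mem_iInter.2 fun v => ⟨hK.1, ?_⟩⟩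
    rw [sum_scaledInverse_col, ← curvature_eq_curvatureVector hG hc]
    exact hp v
  · rintro ⟨_, ⟨c, hc, hn, rfl⟩, hp⟩
    refine ⟨c, hc, fun v => ?_⟩
    rw [hn.curvature_eq hG hc]
    exact (Set.mem_iInter.1 hp v).2
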